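/- Let $\mathbb F_q\subseteq\mathbb F_{q^m}$ be finite fields and let $2\le \ell<\frac n2-1$. For linear codes $U,V\subseteq\mathbb F_{q^m}^n$ let $U^\perp$ be the dual code for the standard inner product and let $U*V$ be the $\mathbb F_{q^m}$-span of all coordinatewise products $u*v$ with $u\in U$, $v\in V$; $k(\cdot)$ and $d(\cdot)$ are dimension and minimum Hamming distance, and $[n,k,d]$ denotes a code of length $n$, dimension $k$ and minimum distance $d$. Let $\mathcal C$ be an $[n,n-2\ell-1,2\ell+2]$ (hence MDS) code over $\mathbb F_q$, and let $(\mathcal A,\mathcal B)$ be an $\ell$-error-correcting pair for $\mathcal C$ over $\mathbb F_{q^m}$. That is, $\mathcal A,\mathcal B\subseteq\mathbb F_{q^m}^n$ are linear codes with $\mathcal A*\mathcal B\perp\mathcal C$, $d(\mathcal B^\perp)>\ell$, $k(\mathcal A)>\ell$ and $d(\mathcal A)+d(\mathcal C)>n$. Suppose that either I. $\mathcal A$ is an $[n,\ell+2,n-\ell-1]$ code, or II. $\mathcal A$ is an $[n,\ell+1,n-\ell]$ code and $d(\mathcal B^\perp)>\ell+1$. For a field $F$, pairwise distinct $\alpha_1,\dots,\alpha_n\in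 F\cup\{\infty\}$, $v_1,\dots,v_n\in F^*$ and $1\le k\le n$, the GRS code over $F$ of dimension $k$ with evaluation-point sequence $(\alpha_i)$ is $\{(v_1f(\alpha_1),\dots,v_nf(\alpha_n)) : f\in F[x],\ \deg f\le k-1\}$, where $f(\infty)$ is the coefficient of $x^{k-1}$ in $f$. Write $\mathcal C_{q^m}$ for the $\mathbb F_{q^m}$-span of $\mathcal C$ in $\mathbb F_{q^m}^n$. Then: (1) There are pairwise distinct $\alpha_1,\dots,\alpha_n\in\mathbb F_q\cup\{\infty\}$ such that $\mathcal C$ is a GRS code over $\mathbb F_q$, and $\mathcal A$ and $\mathcal B$ are GRS codes over $\mathbb F_{q^m}$, all with evaluation-point sequence $(\alpha_1,\dots,\alpha_n)$. If $n\le q$, such a sequence exists with all $\alpha_i\in\mathbb F_q$. If $n\le q^m$, there are pairwise distinct $\alpha_1,\dots,\alpha_n\in\mathbb F_{q^m}$ such that $\mathcal A$, $\mathcal B$ and $\mathcal C_{q^m}$ are all GRS codes over $\mathbb F_{q^m}$ with evaluation-point sequence $(\alpha_1,\dots,\alpha_n)$. (2) $\mathcal B=(\mathcal A*\mathcal C_{q^m})^\perp$.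 No condition on the sizes of the fields is assumed. -/

import Mathlib

open Polynomial

namespace ErrorCorrectingPair

/-- The dual code `{x | x · c = 0 for all c ∈ C}` for the standard inner product. -/
def dualCode {F : Type*} [Field F] {n : ℕ} (C : Submodule F (Fin n → F)) :
    Submodule F (Fin n → F) where
  carrier := {x | ∀ c ∈ C, x ⬝ᵥ c = 0}
  zero_mem' := fun c _ => zero_dotProduct c
  add_mem' := fun {x y} hx hy c hc => by rw [add_dotProduct, hx c hc, hy c hc, add_zero]
  smul_mem' := fun a x hx c hc => by rw [smul_dotProduct, hx c hc, smul_zero]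

open Classical in
/-- The minimum distance of a linear code, that is, the least Hamming weight of a nonzero
codeword. It is `⊤` for the zero code. -/
noncomputable def minDist {F : Type*} [Field F] {n : ℕ} (C : Submodule F (Fin n → F)) : ℕ∞ :=
  ⨅ c ∈ C, ⨅ _ : c ≠ 0, (hammingNorm c : ℕ∞)

/-- `C` is an `[n, k, d]` code: a linear code of length `n`, dimension `k` and minimum
distance `d`. -/
def HasParams {F : Type*} [Field F] {n : ℕ} (C : Submodule F (Fin n → F)) (k d : ℕ) : Prop :=
  Module.finrank F C = k ∧ minDist C = (d : ℕ∞)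

/-- The code over `L` spanned by a code `C` over the subfield `K`. -/
def extendScalars {K : Type*} (L : Type*) [Field K] [Field L] [Algebra K L] {n : ℕ}
    (C : Submodule K (Fin n → K)) : Submodule L (Fin n → L) :=
  Submodule.span L ((fun (c : Fin n → K) (i : Fin n) => algebraMap K L (c i)) '' (C : Set (Fin n → K)))

/-- `(A, B)` is an `ℓ`-error-correcting pair over the extension field `L` for the code `C` over `K`.
The product `A * B` of submodules of the algebra `Fin n → L` is the span of all
coordinatewise products `a * b`, that is, the Schur product of codes. The inclusion of `A * B` in
the dual of `C` is taken over `L`. -/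
structure IsECP {K L : Type*} [Field K] [Field L] [Algebra K L] {n : ℕ} (ℓ : ℕ)
    (A B : Submodule L (Fin n → L)) (C : Submodule K (Fin n → K)) : Prop where
  mul_le_dual : A * B ≤ dualCode (extendScalars L C)
  lt_minDist_dual : (ℓ : ℕ∞) < minDist (dualCode B)
  lt_dim : ℓ < Module.finrank L A
  lt_add : (n : ℕ∞) < minDist A + minDist C

/-- `C` is a generalized Reed-Solomon code with evaluation-point sequence `α`: the points
are pairwise distinct and, for some `1 ≤ k ≤ n` and some sequence `v` of nonzero elements,
`C = {(v₁ f(α₁), …, vₙ f(αₙ)) | deg f ≤ k - 1}`. -/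
def IsGRS {F : Type*} [Field F] {n : ℕ} (α : Fin n → F) (C : Submodule F (Fin n → F)) : Prop :=
  Function.Injective α ∧ ∃ k : ℕ, 1 ≤ k ∧ k ≤ n ∧ ∃ v : Fin n → F, (∀ i, v i ≠ 0) ∧
    ∀ x : Fin n → F, x ∈ C ↔ ∃ f : F[X], f.degree < k ∧ ∀ i, x i = v i * f.eval (α i)

/-- The value at a point of `F ∪ {∞}` of a polynomial `f` of degree at most `k - 1`, where
`f(∞)` is the coefficient of `X ^ (k - 1)`. -/
def evalProj {F : Type*} [Field F] (k : ℕ) (f : F[X]) (p : OnePoint F) : F :=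
  p.elim (f.coeff (k - 1)) (fun a : F => f.eval a)

/-- `C` is a generalized Reed-Solomon code with evaluation-point sequence `α`, where `∞` is
admitted as an evaluation point. -/
def IsProjGRS {F : Type*} [Field F] {n : ℕ} (α : Fin n → OnePoint F)
    (C : Submodule F (Fin n → F)) : Prop :=
  Function.Injective α ∧ ∃ k : ℕ, 1 ≤ k ∧ k ≤ n ∧ ∃ v : Fin n → F, (∀ i, v i ≠ 0) ∧
    ∀ x : Fin n → F, x ∈ C ↔ ∃ f : F[X], f.degree < k ∧ ∀ i, x i = v i * evalProj k f (α i)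

end ErrorCorrectingPair

/-! Over the extension field, `A`, `B` and the span of `C` play symmetric roles: the coordinatewise
product of any two is orthogonal to the third. The distance hypotheses make them separating for `a`,
`b`, `c` with `a + b + c = n + 1`, where `(a, b, c)` is `(ℓ + 2, ℓ, n - 2ℓ - 1)` in case I and `(ℓ +
1, ℓ + 1, n - 2ℓ - 1)` in case II. A product of separating codes separates (`Separates.mul`), so a
word of one code is determined by as many coordinates as that code separates, and all three are MDS;
nothing about the dimension of `B` is needed beforehand.

The rigidity comes from `IsTriple.pencil_eq`. Take a pencil in `X` with `a - 2` base points and a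
pencil in `Y` with `b - 2` others. Matching products of their words differ by a vector orthogonal to
`Z` with `a + b - 1 = n - c` zeros, hence by zero. So both pencils induce the same map from
coordinates to the projective line. Reading this map off words of `C` itself gives points over the
small field (`IsTriple.exists_compatible`).

An MDS code whose pencils match these points is GRS: up to a twist it contains the products of
linear forms vanishing at the points, and these span it (`isTwistedFormCode_of_compatible`).
`IsTriple.transfer` carries the points to the other codes. Working with homogeneous points and
brackets admits infinity, so field sizes play no role until affine points are wanted.

Part (2) follows since enlarging one code of a triple to the dual of the product of the others
yields again a triple (`IsTriple.eq_dualCode`). -/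

namespace ErrorCorrectingPair

variable {F : Type*} [Field F] {n : ℕ}

/-! ### Separating codes, minimum distance and duality -/

/-- Any `k` coordinates are linearly independent as functionals on the code `X`. -/
def Separates (X : Submodule F (Fin n → F)) (k : ℕ) : Prop :=
  ∀ T : Finset (Fin n), T.card < k → ∀ s ∉ T, ∃ x ∈ X, (∀ t ∈ T, x t = 0) ∧ x s ≠ 0

theorem Separates.mono {X Y : Submodule F (Fin n → F)} {k : ℕ} (h : Separates X k)
    (hXY : X ≤ Y) : Separates Y k := fun T hT s hs =>
  let ⟨x, hx, h0, h1⟩ := h T hT s hs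
  ⟨x, hXY hx, h0, h1⟩

theorem Separates.mul {X Y : Submodule F (Fin n → F)} {a b : ℕ} (hX : Separates X (a + 1))
    (hY : Separates Y (b + 1)) : Separates (X * Y) (a + b + 1) := by
  intro T hT s hs
  -- The first factor kills up to `a` of the points of `T`, the second the at most `b` remaining
  -- ones.
  obtain ⟨T₁, hT₁, hc⟩ := Finset.exists_subset_card_eq (min_le_left T.card a)
  obtain ⟨x, hx, hx0, hxs⟩ := hX T₁ (by omega) s (fun h => hs (hT₁ h))
  have hcard := Finset.card_sdiff_add_card_eq_card hT₁
  obtain ⟨y, hy, hy0, hys⟩ := hY (T \ T₁) (by omega) s (fun h => hs (Finset.mem_sdiff.1 h).1)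
  refine ⟨x * y, Submodule.mul_mem_mul hx hy, fun t ht => ?_, mul_ne_zero hxs hys⟩
  by_cases h : t ∈ T₁
  · simp [hx0 t h]
  · simp [hy0 t (Finset.mem_sdiff.2 ⟨ht, h⟩)]

/-- A vector orthogonal to a separating code has large weight. -/
theorem Separates.eq_zero_of_orthogonal {X : Submodule F (Fin n → F)} {k : ℕ}
    (hX : Separates X k) {d : Fin n → F} (hd : ∀ x ∈ X, d ⬝ᵥ x = 0) {T : Finset (Fin n)}
    (hT : ∀ t ∈ T, d t = 0) (hc : n ≤ T.card + k) : d = 0 := by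
  funext s
  by_contra hs
  have hsT : s ∉ T := fun h => hs (hT s h)
  have hcompl : (Tᶜ.erase s).card < k := by
    have h1 := Finset.card_erase_lt_of_mem (Finset.mem_compl.2 hsT)
    have h2 := Finset.card_compl T
    rw [Fintype.card_fin] at h2
    omega
  obtain ⟨x, hx, hx0, hxs⟩ := hX _ hcompl s (Finset.notMem_erase _ _)
  have h := hd x hx
  rw [dotProduct, Finset.sum_eq_single s] at h
  · exact (mul_ne_zero hs hxs) h
  · intro t _ hts
    by_cases h : t ∈ T
    · simp [hT t h]
    · simp [hx0 t (Finset.mem_erase.2 ⟨hts, Finset.mem_compl.2 h⟩)]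
  · simp

theorem minDist_le {X : Submodule F (Fin n → F)} {c : Fin n → F} (hc : c ∈ X) (h0 : c ≠ 0)
    {T : Finset (Fin n)} (hT : ∀ t ∉ T, c t = 0) : minDist X ≤ (T.card : ℕ∞) := by
  classical
  refine ((iInf₂_le c hc).trans (iInf_le _ h0)).trans ?_
  simp only [Nat.cast_le]
  unfold hammingNorm
  refine Finset.card_le_card fun t ht => ?_
  by_contra h
  simp [hT t h] at ht

/-- By dimension, some nonzero word vanishes on any `k - 1` coordinates; a further zero would push
its weight down to `n - k`. -/
theorem separates_of_lt_minDist {X : Submodule F (Fin n → F)} {k : ℕ}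
    (hk : Module.finrank F X = k) (hkn : k ≤ n) (hd : (n : ℕ∞) < minDist X + k) :
    Separates X k := by
  intro T hT s hs
  have hsc : T ⊆ ({s} : Finset (Fin n))ᶜ := fun t ht => by
    simpa using fun h : t = s => hs (h ▸ ht)
  obtain ⟨U, hTU, hUs, hU⟩ := Finset.exists_subsuperset_card_eq (n := k - 1) hsc (by omega)
    (by rw [Finset.card_compl, Fintype.card_fin, Finset.card_singleton]; omega)
  let ρ : X →ₗ[F] (U → F) := (LinearMap.funLeft F F (Subtype.val : U → Fin n)).comp X.subtype
  have hker : LinearMap.ker ρ ≠ ⊥ := LinearMap.ker_ne_bot_of_finrank_lt (by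
    rw [Module.finrank_fintype_fun_eq_card, Fintype.card_coe, hk]; omega)
  obtain ⟨x, hx, hx0⟩ := Submodule.exists_mem_ne_zero_of_ne_bot hker
  have hxU : ∀ t ∈ U, (x : Fin n → F) t = 0 := fun t ht => congrFun hx ⟨t, ht⟩
  refine ⟨x, x.2, fun t ht => hxU t (hTU ht), fun hxs => ?_⟩
  have hsU : s ∉ U := fun h => by simpa using hUs h
  have h := minDist_le (T := (insert s U)ᶜ) x.2 (by simpa using hx0) (fun t ht => by
    rw [Finset.mem_compl, not_not, Finset.mem_insert] at ht
    rcases ht with rfl | ht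
    · exact hxs
    · exact hxU t ht)
  rw [Finset.card_compl, Fintype.card_fin, Finset.card_insert_of_notMem hsU] at h
  have h2 := hd.trans_le (add_le_add_left h (k : ℕ∞))
  norm_cast at h2
  omega

/-- If restriction to a set of at most `k` coordinates is not onto, a functional killing its image
is a dual word supported on that set. -/
theorem separates_of_lt_minDist_dualCode {X : Submodule F (Fin n → F)} {k : ℕ}
    (hd : (k : ℕ∞) < minDist (dualCode X)) : Separates X k := by
  intro T hT s hs
  set U := insert s T with hU
  let ρ : X →ₗ[F] (U → F) := (LinearMap.funLeft F F (Subtype.val : U → Fin n)).comp X.subtype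
  by_cases hsurj : LinearMap.range ρ = ⊤
  · obtain ⟨x, hx⟩ := LinearMap.range_eq_top.1 hsurj (Pi.single ⟨s, by simp [hU]⟩ 1)
    refine ⟨x, x.2, fun t ht => ?_, ?_⟩
    · have h := congrFun hx ⟨t, by simp [hU, ht]⟩
      rw [Pi.single_eq_of_ne (by simpa using fun h : t = s => hs (h ▸ ht))] at h
      exact h
    · have h := congrFun hx ⟨s, by simp [hU]⟩
      rw [Pi.single_eq_same] at h
      exact fun h0 => one_ne_zero (h.symm.trans h0)
  · exfalso
    obtain ⟨f, hf, hle⟩ := Submodule.exists_le_ker_of_lt_top _ (lt_top_iff_ne_top.2 hsurj)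
    let h : Fin n → F := fun t => if ht : t ∈ U then f (Pi.single ⟨t, ht⟩ 1) else 0
    have hdot : ∀ x : Fin n → F, h ⬝ᵥ x = f (fun t : U => x t) := by
      intro x
      rw [LinearMap.pi_apply_eq_sum_univ f, dotProduct, ← Finset.sum_subset (Finset.subset_univ U)]
      · rw [← Finset.sum_coe_sort U]
        refine Finset.sum_congr rfl fun t _ => ?_
        simp only [h, t.2, dif_pos, smul_eq_mul]
        rw [mul_comm]
        congr 2
        funext j
        simp [Pi.single_apply, eq_comm]
      · intro t _ ht
        simp [h, ht]
    have hmem : h ∈ dualCode X := fun x hx => by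
      rw [hdot]
      exact hle ⟨⟨x, hx⟩, rfl⟩
    have hne : h ≠ 0 := fun h0 => hf (LinearMap.ext fun g => by
      have := hdot (fun t => if ht : t ∈ U then g ⟨t, ht⟩ else 0)
      rw [h0, zero_dotProduct] at this
      simpa using this.symm)
    have := hd.trans_le (minDist_le (T := U) hmem hne fun t ht => by simp [h, ht])
    rw [hU, Finset.card_insert_of_notMem hs] at this
    norm_cast at this
    omega

/-! ### Triples of codes and their pencils -/

/-- Three codes of dimensions `a`, `b`, `c` with `a + b + c = n + 1`, all of them MDS, such that
the product of any two is orthogonal to the third. -/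
structure IsTriple (X Y Z : Submodule F (Fin n → F)) (a b c : ℕ) : Prop where
  left : Separates X a
  mid : Separates Y b
  right : Separates Z c
  two_le_left : 2 ≤ a
  two_le_mid : 2 ≤ b
  two_le_right : 2 ≤ c
  add_eq : a + b + c = n + 1
  orthogonal : ∀ x ∈ X, ∀ y ∈ Y, ∀ z ∈ Z, (x * y) ⬝ᵥ z = 0

namespace IsTriple

variable {X Y Z : Submodule F (Fin n → F)} {a b c : ℕ}

theorem swap (h : IsTriple X Y Z a b c) : IsTriple Y X Z b a c where
  left := h.mid
  mid := h.left
  right := h.right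
  two_le_left := h.two_le_mid
  two_le_mid := h.two_le_left
  two_le_right := h.two_le_right
  add_eq := by have := h.add_eq; omega
  orthogonal := fun y hy x hx z hz => by rw [mul_comm]; exact h.orthogonal x hx y hy z hz

theorem rotate (h : IsTriple X Y Z a b c) : IsTriple Y Z X b c a where
  left := h.mid
  mid := h.right
  right := h.left
  two_le_left := h.two_le_mid
  two_le_mid := h.two_le_right
  two_le_right := h.two_le_left
  add_eq := by have := h.add_eq; omega
  orthogonal := fun y hy z hz x hx => by
    rw [← h.orthogonal x hx y hy z hz]
    exact Finset.sum_congr rfl fun i _ => by simp only [Pi.mul_apply]; ring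

/-- A word of `X` is orthogonal to `Y * Z`, which separates `b + c - 1 = n - a` coordinates. -/
theorem eq_zero (h : IsTriple X Y Z a b c) {x : Fin n → F} (hx : x ∈ X) {T : Finset (Fin n)}
    (hT : ∀ t ∈ T, x t = 0) (hc : a ≤ T.card) : x = 0 := by
  obtain ⟨b, rfl⟩ := Nat.exists_eq_add_of_le' (by have := h.two_le_mid; omega : 1 ≤ b)
  obtain ⟨c, rfl⟩ := Nat.exists_eq_add_of_le' (by have := h.two_le_right; omega : 1 ≤ c)
  refine (h.mid.mul h.right).eq_zero_of_orthogonal (fun w hw => ?_) hT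
    (by have := h.add_eq; omega)
  induction hw using Submodule.mul_induction_on' with
  | mem_mul_mem y hy z hz =>
    rw [← h.orthogonal x hx y hy z hz]
    exact Finset.sum_congr rfl fun i _ => by simp only [Pi.mul_apply]; ring
  | add u _ v _ hu hv => rw [dotProduct_add, hu, hv, add_zero]

/-- Two words of `X` with `a - 1` common zeros are proportional. -/
theorem mul_eq_mul (h : IsTriple X Y Z a b c) {u v : Fin n → F} (hu : u ∈ X) (hv : v ∈ X)
    {T : Finset (Fin n)} (hTu : ∀ t ∈ T, u t = 0) (hTv : ∀ t ∈ T, v t = 0)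
    (hc : a ≤ T.card + 1) (k l : Fin n) : u k * v l = u l * v k := by
  by_cases hl : l ∈ T
  · simp [hTu l hl, hTv l hl]
  have h0 : v l • u - u l • v = 0 := by
    refine h.eq_zero (T := insert l T) (X.sub_mem (X.smul_mem _ hu) (X.smul_mem _ hv))
      (fun t ht => ?_) (by rwa [Finset.card_insert_of_notMem hl])
    rcases Finset.mem_insert.1 ht with rfl | ht
    · simp [mul_comm]
    · simp [hTu t ht, hTv t ht]
  have := congrFun h0 k
  simp only [Pi.sub_apply, Pi.smul_apply, smul_eq_mul, Pi.zero_apply] at this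
  linear_combination this

/-- The pencils cut out in `X` and in `Y` by disjoint sets `I` and `J` have the same
cross-ratios. -/
theorem pencil_eq (h : IsTriple X Y Z a b c) {x y z w : Fin n → F} (hx : x ∈ X) (hy : y ∈ X)
    (hz : z ∈ Y) (hw : w ∈ Y) {I J : Finset (Fin n)} (hI : a ≤ I.card + 2) (hJ : b ≤ J.card + 2)
    (hIJ : Disjoint I J) {p q r : Fin n} (hpq : p ≠ q) (hpr : p ≠ r) (hqr : q ≠ r)
    (hp : p ∉ I ∪ J) (hq : q ∉ I ∪ J) (hr : r ∉ I ∪ J)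
    (hxI : ∀ t ∈ I, x t = 0) (hyI : ∀ t ∈ I, y t = 0)
    (hzJ : ∀ t ∈ J, z t = 0) (hwJ : ∀ t ∈ J, w t = 0)
    (hxp : x p = 0) (hyq : y q = 0) (hzp : z p = 0) (hwq : w q = 0) (k : Fin n) :
    x k * w k * (y r * z r) = y k * z k * (x r * w r) := by
  -- The zeros number `(a - 2) + (b - 2) + 3 = n - c`: base points, the common zeros at `p` and `q`,
  -- and one at `r` forced by the choice of scalars.
  have h0 : (y r * z r) • (x * w) - (x r * w r) • (y * z) = 0 := by
    refine h.right.eq_zero_of_orthogonal (T := insert p (insert q (insert r (I ∪ J))))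
      (fun v hv => ?_) (fun t ht => ?_) ?_
    · rw [sub_dotProduct, smul_dotProduct, smul_dotProduct, h.orthogonal x hx w hw v hv,
        h.orthogonal y hy z hz v hv, smul_zero, smul_zero, sub_zero]
    · simp only [Finset.mem_insert, Finset.mem_union] at ht
      simp only [Pi.sub_apply, Pi.smul_apply, Pi.mul_apply, smul_eq_mul]
      rcases ht with rfl | rfl | rfl | ht | ht
      · simp [hxp, hzp]
      · simp [hyq, hwq]
      · ring
      · simp [hxI t ht, hyI t ht]
      · simp [hzJ t ht, hwJ t ht]
    · rw [Finset.card_insert_of_notMem (by simp only [Finset.mem_insert]; tauto),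
        Finset.card_insert_of_notMem (by simp only [Finset.mem_insert]; tauto),
        Finset.card_insert_of_notMem hr, Finset.card_union_of_disjoint hIJ]
      have := h.add_eq
      omega
  have := congrFun h0 k
  simp only [Pi.sub_apply, Pi.smul_apply, Pi.mul_apply, smul_eq_mul, Pi.zero_apply] at this
  linear_combination this

end IsTriple

/-! ### Points of the projective line, brackets and forms -/

/-- The value at the point `(x k : y k)` of the linear form vanishing at `(x i : y i)`. -/
def bracket (x y : Fin n → F) (i k : Fin n) : F := x k * y i - y k * x i

theorem bracket_self (x y : Fin n → F) (i : Fin n) : bracket x y i i = 0 := by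
  rw [bracket]; ring

theorem prod_bracket_eq_zero (x y : Fin n → F) {T : Finset (Fin n)} {k : Fin n} (hk : k ∈ T) :
    ∏ i ∈ T, bracket x y i k = 0 := Finset.prod_eq_zero hk (bracket_self x y k)

/-- For `S` of size `dim X`, the pencils in `X` of words vanishing on all but two elements of `S`
have the cross-ratios of the points `(x k : y k)`. -/
def Compatible (X : Submodule F (Fin n → F)) (x y : Fin n → F) (S : Finset (Fin n)) : Prop :=
  ∀ i ∈ S, ∀ j ∈ S, i ≠ j → ∀ u ∈ X, ∀ v ∈ X, (∀ t ∈ S, t ≠ j → u t = 0) →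
    (∀ t ∈ S, t ≠ i → v t = 0) → ∀ k ∉ S, ∀ l ∉ S,
      u k * bracket x y j k * (v l * bracket x y i l) =
        u l * bracket x y j l * (v k * bracket x y i k)

open Classical in
/-- The point of the projective line with homogeneous coordinates `(s : t)`. -/
noncomputable def toOnePoint (s t : F) : OnePoint F :=
  if t = 0 then OnePoint.infty else ((s / t : F) : OnePoint F)

theorem toOnePoint_of_ne_zero (s : F) {t : F} (ht : t ≠ 0) :
    toOnePoint s t = ((s / t : F) : OnePoint F) := if_neg ht

theorem map_toOnePoint {E : Type*} [Field E] (φ : F →+* E) (s t : F) :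
    OnePoint.map φ (toOnePoint s t) = toOnePoint (φ s) (φ t) := by
  by_cases ht : t = 0
  · simp [toOnePoint, ht]
  · simp [toOnePoint, ht, OnePoint.map_some]

theorem toOnePoint_injective {x y : Fin n → F} (hxy : ∀ i k, i ≠ k → bracket x y i k ≠ 0) :
    Function.Injective fun k => toOnePoint (x k) (y k) := by
  intro i k hik
  by_contra hne
  refine hxy i k hne ?_
  simp only [toOnePoint, bracket] at hik ⊢
  split_ifs at hik with hi hk hk
  · rw [hi, hk]; ring
  · exact absurd hik.symm (OnePoint.coe_ne_infty _)
  · exact absurd hik (OnePoint.coe_ne_infty _)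
  · rw [OnePoint.coe_eq_coe, div_eq_div_iff hi hk] at hik
    linear_combination -hik

open Classical in
/-- The ratio between the values at `(s, t)` of a form of degree `k` and at the corresponding point
of the projective line of its dehomogenization. -/
noncomputable def formScale (k : ℕ) (s t : F) : F := if t = 0 then s ^ k else t ^ k

theorem formScale_ne_zero (k : ℕ) {s t : F} (h : s ≠ 0 ∨ t ≠ 0) : formScale k s t ≠ 0 := by
  unfold formScale
  split_ifs with ht
  · exact pow_ne_zero _ (h.resolve_right fun h => h ht)
  · exact pow_ne_zero _ ht

/-- A product of linear forms is the homogenization of a polynomial. -/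
theorem exists_prod_bracket_eq (x y : Fin n → F) (T : Finset (Fin n)) :
    ∃ f : F[X], f.degree < ((T.card + 1 : ℕ) : WithBot ℕ) ∧ ∀ k, ∏ i ∈ T, bracket x y i k =
      formScale T.card (x k) (y k) * evalProj (T.card + 1) f (toOnePoint (x k) (y k)) := by
  have hdeg : ∀ i ∈ T, (C (y i) * X - C (x i) : F[X]).natDegree ≤ 1 := fun i _ =>
    natDegree_sub_C.trans_le ((natDegree_C_mul_le _ _).trans natDegree_X_le)
  refine ⟨∏ i ∈ T, (C (y i) * X - C (x i)), ?_, fun k => ?_⟩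
  · refine (degree_le_natDegree).trans_lt ?_
    have := (natDegree_prod_le T fun i => (C (y i) * X - C (x i) : F[X])).trans
      (Finset.sum_le_card_nsmul T _ 1 hdeg)
    rw [smul_eq_mul, mul_one] at this
    exact_mod_cast Nat.lt_succ_of_le this
  · by_cases hk : y k = 0
    -- At infinity, the coefficient of degree `T.card` is the product of the linear coefficients,
    -- even when some factors are constant.
    · have hcoeff := coeff_prod_of_natDegree_le (s := T)
        (fun i => (C (y i) * X - C (x i) : F[X])) 1 hdeg
      rw [mul_one] at hcoeff
      simp only [toOnePoint, formScale, if_pos hk, evalProj, OnePoint.elim_infty,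
        Nat.add_sub_cancel, hcoeff, bracket]
      rw [← Finset.prod_const, ← Finset.prod_mul_distrib]
      refine Finset.prod_congr rfl fun i _ => ?_
      simp [hk, coeff_C]
    · simp only [toOnePoint, formScale, if_neg hk, evalProj, OnePoint.elim_some, bracket,
        eval_prod]
      rw [← Finset.prod_const, ← Finset.prod_mul_distrib]
      refine Finset.prod_congr rfl fun i _ => ?_
      simp only [eval_sub, eval_mul, eval_C, eval_X]
      field_simp

theorem evalProj_add (k : ℕ) (f g : F[X]) (p : OnePoint F) :
    evalProj k (f + g) p = evalProj k f p + evalProj k g p := by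
  induction p using OnePoint.rec with
  | infty => simp [evalProj]
  | coe a => simp [evalProj]

theorem evalProj_smul (k : ℕ) (r : F) (f : F[X]) (p : OnePoint F) :
    evalProj k (r • f) p = r * evalProj k f p := by
  induction p using OnePoint.rec with
  | infty => simp [evalProj]
  | coe a => simp [evalProj]

/-- The evaluation map of a GRS code. -/
noncomputable def grsMap (k : ℕ) (α : Fin n → OnePoint F) (v : Fin n → F) :
    degreeLT F k →ₗ[F] (Fin n → F) where
  toFun f i := v i * evalProj k f (α i)
  map_add' f g := by ext i; simp [evalProj_add, mul_add]
  map_smul' r f := by ext i; simp [evalProj_smul, mul_left_comm]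

theorem isProjGRS_of_range_eq {k : ℕ} (hk : 1 ≤ k) (hkn : k ≤ n) {α : Fin n → OnePoint F}
    (hα : Function.Injective α) {v : Fin n → F} (hv : ∀ i, v i ≠ 0)
    {X : Submodule F (Fin n → F)} (hX : LinearMap.range (grsMap k α v) = X) : IsProjGRS α X := by
  refine ⟨hα, k, hk, hkn, v, hv, fun x => ?_⟩
  rw [← hX, LinearMap.mem_range]
  constructor
  · rintro ⟨f, rfl⟩
    exact ⟨f, mem_degreeLT.1 f.2, fun i => rfl⟩
  · rintro ⟨f, hf, hx⟩
    exact ⟨⟨f, mem_degreeLT.2 hf⟩, funext fun i => (hx i).symm⟩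

/-- Words vanishing on all of `S` but one point make the restriction to `S` surjective. -/
theorem Separates.le_finrank {X : Submodule F (Fin n → F)} {k : ℕ} (hX : Separates X k)
    {S : Finset (Fin n)} (hS : S.card ≤ k) : S.card ≤ Module.finrank F X := by
  let ρ : X →ₗ[F] (S → F) := (LinearMap.funLeft F F (Subtype.val : S → Fin n)).comp X.subtype
  have hρ : Function.Surjective ρ := by
    rw [← LinearMap.range_eq_top, eq_top_iff, ← (Pi.basisFun F S).span_eq, Submodule.span_le]
    rintro _ ⟨s, rfl⟩
    obtain ⟨x, hx, hx0, hxs⟩ := hX (S.erase s)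
      ((Finset.card_erase_lt_of_mem s.2).trans_le hS) s (Finset.notMem_erase _ _)
    refine ⟨(x s)⁻¹ • ⟨x, hx⟩, funext fun t => ?_⟩
    change (x s)⁻¹ * x t = Pi.basisFun F S s t
    rw [Pi.basisFun_apply]
    by_cases hts : t = s
    · subst hts
      rw [Pi.single_eq_same, inv_mul_cancel₀ hxs]
    · rw [Pi.single_eq_of_ne hts, hx0 t (Finset.mem_erase.2
        ⟨fun h => hts (Subtype.ext h), t.2⟩), mul_zero]
  have := LinearMap.finrank_le_finrank_of_surjective hρ
  rwa [Module.finrank_fintype_fun_eq_card, Fintype.card_coe] at this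

/-! ### Recognizing GRS codes -/

/-- An MDS code with compatible points contains, up to a common twist `v`, the products of the
linear forms vanishing at the points of `S \ {s}`, for all `s ∈ S`. -/
theorem exists_twist_of_compatible {X : Submodule F (Fin n → F)} {S : Finset (Fin n)}
    (hX : Separates X S.card)
    (hX0 : ∀ u ∈ X, ∀ T : Finset (Fin n), (∀ t ∈ T, u t = 0) → S.card ≤ T.card → u = 0)
    (hS : S.Nonempty) (hSn : S.card < n) {x y : Fin n → F}
    (hxy : ∀ i k, i ≠ k → bracket x y i k ≠ 0) (hc : Compatible X x y S) :
    ∃ v : Fin n → F, (∀ k, v k ≠ 0) ∧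
      ∀ s ∈ S, (fun k => v k * ∏ i ∈ S.erase s, bracket x y i k) ∈ X := by
  obtain ⟨s₀, hs₀⟩ := hS
  obtain ⟨l, hl⟩ : ∃ l, l ∉ S := by
    by_contra! h
    rw [Finset.eq_univ_iff_forall.2 h, Finset.card_univ, Fintype.card_fin] at hSn
    exact lt_irrefl _ hSn
  -- Normalizing at one point `l` outside `S` makes `u s k * bracket x y s k` independent of `s` for
  -- every `k` outside `S`.
  have hu : ∀ s, ∃ u ∈ X, s ∈ S → (∀ t ∈ S.erase s, u t = 0) ∧ u l * bracket x y s l = 1 := by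
    intro s
    by_cases hs : s ∈ S
    · obtain ⟨u, hu, hu0, hul⟩ := hX (S.erase s) (Finset.card_erase_lt_of_mem hs) l
        (fun h => hl (Finset.mem_of_mem_erase h))
      have hb : bracket x y s l ≠ 0 := hxy s l fun h => hl (h ▸ hs)
      refine ⟨(u l * bracket x y s l)⁻¹ • u, X.smul_mem _ hu, fun _ => ⟨fun t ht => ?_, ?_⟩⟩
      · simp [hu0 t ht]
      · simp only [Pi.smul_apply, smul_eq_mul]
        field_simp
    · exact ⟨0, X.zero_mem, fun h => absurd h hs⟩
  choose u huX hu using hu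
  have hne : ∀ s ∈ S, ∀ k, k ∉ S.erase s → u s k ≠ 0 := by
    intro s hs k hk h0
    have h := hX0 _ (huX s) (insert k (S.erase s)) (fun t ht => by
      rcases Finset.mem_insert.1 ht with rfl | ht
      · exact h0
      · exact (hu s hs).1 t ht) (by
        rw [Finset.card_insert_of_notMem hk, Finset.card_erase_add_one hs])
    have h1 := (hu s hs).2
    rw [h] at h1
    simp at h1
  have hcomp : ∀ s ∈ S, ∀ k ∉ S, u s k * bracket x y s k = u s₀ k * bracket x y s₀ k := by
    intro s hs k hk
    by_cases hss : s = s₀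
    · rw [hss]
    have h := hc s₀ hs₀ s hs (Ne.symm hss) _ (huX s) _ (huX s₀)
      (fun t ht hts => (hu s hs).1 t (Finset.mem_erase.2 ⟨hts, ht⟩))
      (fun t ht hts => (hu s₀ hs₀).1 t (Finset.mem_erase.2 ⟨hts, ht⟩)) k hk l hl
    rwa [(hu s hs).2, (hu s₀ hs₀).2, mul_one, one_mul] at h
  have hprod : ∀ T : Finset (Fin n), ∀ k ∉ T, ∏ i ∈ T, bracket x y i k ≠ 0 := fun T k hk =>
    Finset.prod_ne_zero_iff.2 fun i hi => hxy i k fun h => hk (h ▸ hi)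
  -- At `k ∈ S` only `u k` is nonzero, so it alone fixes the twist there; elsewhere every `s` gives
  -- the same value.
  refine ⟨fun k => if k ∈ S then u k k / ∏ i ∈ S.erase k, bracket x y i k else
    u s₀ k * bracket x y s₀ k / ∏ i ∈ S, bracket x y i k, fun k => ?_, fun s hs => ?_⟩
  · dsimp only
    split_ifs with hk
    · exact div_ne_zero (hne k hk k (Finset.notMem_erase _ _))
        (hprod _ _ (Finset.notMem_erase _ _))
    · exact div_ne_zero (mul_ne_zero
        (hne s₀ hs₀ k fun h => hk (Finset.mem_of_mem_erase h))
        (hxy _ _ fun h => hk (h ▸ hs₀))) (hprod _ _ hk)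
  · convert huX s using 1
    funext k
    dsimp only
    by_cases hks : k = s
    · subst hks
      rw [if_pos hs, div_mul_cancel₀ _ (hprod _ _ (Finset.notMem_erase _ _))]
    by_cases hk : k ∈ S
    · have hk' := Finset.mem_erase.2 ⟨hks, hk⟩
      rw [(hu s hs).1 k hk', prod_bracket_eq_zero x y hk', mul_zero]
    · rw [if_neg hk, ← hcomp s hs k hk, ← Finset.mul_prod_erase _ _ hs]
      have h1 := hxy s k fun h => hks h.symm
      have h2 := hprod (S.erase s) k fun h => hk (Finset.mem_of_mem_erase h)
      field_simp

theorem ne_zero_of_bracket {x y : Fin n → F} (hn : 2 ≤ n)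
    (hxy : ∀ i k, i ≠ k → bracket x y i k ≠ 0) (k : Fin n) : x k ≠ 0 ∨ y k ≠ 0 := by
  have : Nontrivial (Fin n) := Fin.nontrivial_iff_two_le.2 hn
  obtain ⟨i, hi⟩ := exists_ne k
  by_contra! h
  exact hxy i k hi (by rw [bracket, h.1, h.2]; ring)

/-- `X` is a GRS code with points `(x k : y k)` and contains, up to a common twist, all products of
`a - 1` of the linear forms vanishing at these points. -/
structure IsTwistedFormCode (X : Submodule F (Fin n → F)) (x y : Fin n → F) (a : ℕ) : Prop where
  isProjGRS : IsProjGRS (fun k => toOnePoint (x k) (y k)) X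
  exists_twist : ∃ v : Fin n → F, (∀ k, v k ≠ 0) ∧ ∀ T : Finset (Fin n), T.card + 1 = a →
    (fun k => v k * ∏ i ∈ T, bracket x y i k) ∈ X

theorem isTwistedFormCode_of_compatible {X : Submodule F (Fin n → F)} {S : Finset (Fin n)}
    (hX : Separates X S.card)
    (hX0 : ∀ u ∈ X, ∀ T : Finset (Fin n), (∀ t ∈ T, u t = 0) → S.card ≤ T.card → u = 0)
    (hS : S.Nonempty) (hSn : S.card < n) {x y : Fin n → F}
    (hxy : ∀ i k, i ≠ k → bracket x y i k ≠ 0) (hc : Compatible X x y S) :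
    IsTwistedFormCode X x y S.card := by
  obtain ⟨v, hv, hvX⟩ := exists_twist_of_compatible hX hX0 hS hSn hxy hc
  have hpos := hS.card_pos
  set α : Fin n → OnePoint F := fun k => toOnePoint (x k) (y k)
  set w : Fin n → F := fun k => v k * formScale (S.card - 1) (x k) (y k)
  have hform : ∀ T : Finset (Fin n), T.card + 1 = S.card →
      (fun k => v k * ∏ i ∈ T, bracket x y i k) ∈ LinearMap.range (grsMap S.card α w) := by
    intro T hT
    obtain ⟨f, hf, hfT⟩ := exists_prod_bracket_eq x y T
    rw [hT] at hf
    refine ⟨⟨f, mem_degreeLT.2 hf⟩, funext fun k => ?_⟩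
    change v k * formScale (S.card - 1) (x k) (y k) * evalProj S.card f _ = _
    rw [hfT k, ← hT, Nat.add_sub_cancel, mul_assoc]
  have hle : X ≤ LinearMap.range (grsMap S.card α w) := by
    intro z hz
    -- Lagrange interpolation on `S`, with the twisted products as basis.
    have hz0 : z - ∑ s ∈ S, (z s / (v s * ∏ i ∈ S.erase s, bracket x y i s)) •
        (fun k => v k * ∏ i ∈ S.erase s, bracket x y i k) = 0 := by
      refine hX0 _ (X.sub_mem hz (X.sum_mem fun s hs => X.smul_mem _ (hvX s hs))) S
        (fun t ht => ?_) le_rfl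
      rw [Pi.sub_apply, Finset.sum_apply, Finset.sum_eq_single_of_mem t ht]
      · have h1 : ∏ i ∈ S.erase t, bracket x y i t ≠ 0 :=
          Finset.prod_ne_zero_iff.2 fun i hi => hxy i t (Finset.ne_of_mem_erase hi)
        have h2 := hv t
        rw [Pi.smul_apply, smul_eq_mul, div_mul_cancel₀ _ (mul_ne_zero h2 h1), sub_self]
      · intro s _ hst
        rw [Pi.smul_apply]
        rw [prod_bracket_eq_zero x y (Finset.mem_erase.2 ⟨Ne.symm hst, ht⟩), mul_zero, smul_zero]
    rw [sub_eq_zero] at hz0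
    rw [hz0]
    exact Submodule.sum_mem _ fun s hs =>
      Submodule.smul_mem _ _ (hform _ (Finset.card_erase_add_one hs))
  have hrange : X = LinearMap.range (grsMap S.card α w) := by
    refine Submodule.eq_of_le_of_finrank_le hle ?_
    refine le_trans ?_ (hX.le_finrank le_rfl)
    refine (LinearMap.finrank_range_le _).trans_eq ?_
    rw [(degreeLTEquiv F S.card).finrank_eq, Module.finrank_fin_fun]
  refine ⟨isProjGRS_of_range_eq hpos hSn.le (toOnePoint_injective hxy) (fun k => mul_ne_zero (hv k)
    (formScale_ne_zero _ (ne_zero_of_bracket (by omega) hxy k))) hrange.symm, v, hv,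
    fun T hT => hrange ▸ hform T hT⟩

/-! ### Transfer of points within a triple -/

theorem IsTriple.compatible {X Y Z : Submodule F (Fin n → F)} {a b c : ℕ}
    (h : IsTriple X Y Z a b c) {x y : Fin n → F} (hxy : ∀ i k, i ≠ k → bracket x y i k ≠ 0)
    (hX : IsTwistedFormCode X x y a) {S : Finset (Fin n)} (hS : S.card = b) :
    Compatible Y x y S := by
  intro i hi j hj hij u hu v hv huj hvi k hk l hl
  by_cases hkl : k = l
  · rw [hkl]
  obtain ⟨w, hw, hwX⟩ := hX.exists_twist
  have hadd := h.add_eq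
  have ha := h.two_le_left
  have hc := h.two_le_right
  have hcard : (insert k (insert l S)).card = b + 2 := by
    rw [Finset.card_insert_of_notMem (by simp [hkl, hk]), Finset.card_insert_of_notMem hl, hS]
  -- The twisted products over `insert i I` and `insert j I` form a pencil in `X` with known values.
  -- It is compared with the pencil of `u` and `v`, whose base is `S` without `i` and `j`.
  obtain ⟨I, hIs, hI⟩ := Finset.exists_subset_card_eq (n := a - 2) (s := (insert k (insert l S))ᶜ)
    (by rw [Finset.card_compl, Fintype.card_fin, hcard]; omega)
  have hdisj : ∀ t ∈ I, t ≠ k ∧ t ≠ l ∧ t ∉ S := fun t ht => by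
    have := hIs ht
    simpa only [Finset.mem_compl, Finset.mem_insert, not_or] using this
  have hiI : i ∉ I := fun h => (hdisj i h).2.2 hi
  have hjI : j ∉ I := fun h => (hdisj j h).2.2 hj
  have hkI : k ∉ I := fun h => (hdisj k h).1 rfl
  have hlI : l ∉ I := fun h => (hdisj l h).2.1 rfl
  have key := h.pencil_eq (hwX (insert i I) (by rw [Finset.card_insert_of_notMem hiI]; omega))
    (hwX (insert j I) (by rw [Finset.card_insert_of_notMem hjI]; omega)) hu hv
    (I := I) (J := (S.erase i).erase j) (by omega)
    (by rw [Finset.card_erase_of_mem (Finset.mem_erase.2 ⟨Ne.symm hij, hj⟩),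
          Finset.card_erase_of_mem hi]; omega)
    (Finset.disjoint_left.2 fun t ht h => (hdisj t ht).2.2
      (Finset.mem_of_mem_erase (Finset.mem_of_mem_erase h)))
    hij (r := l) (fun h => hl (h ▸ hi)) (fun h => hl (h ▸ hj))
    (by simp [hiI]) (by simp [hjI]) (by simp [hlI, hl])
    (fun t ht => by
      simp only [prod_bracket_eq_zero x y (Finset.mem_insert_of_mem ht), mul_zero])
    (fun t ht => by
      simp only [prod_bracket_eq_zero x y (Finset.mem_insert_of_mem ht), mul_zero])
    (fun t ht => huj t (Finset.mem_of_mem_erase (Finset.mem_of_mem_erase ht))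
      (Finset.ne_of_mem_erase ht))
    (fun t ht => hvi t (Finset.mem_of_mem_erase (Finset.mem_of_mem_erase ht))
      (Finset.ne_of_mem_erase (Finset.mem_of_mem_erase ht)))
    (by simp only [prod_bracket_eq_zero x y (Finset.mem_insert_self i I), mul_zero])
    (by simp only [prod_bracket_eq_zero x y (Finset.mem_insert_self j I), mul_zero])
    (huj i hi hij) (hvi j hj (Ne.symm hij)) k
  simp only [Finset.prod_insert hiI, Finset.prod_insert hjI] at key
  have hprod : ∀ m ∉ I, w m * ∏ i ∈ I, bracket x y i m ≠ 0 := fun m hm =>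
    mul_ne_zero (hw m) (Finset.prod_ne_zero_iff.2 fun i hi => hxy i m fun h => hm (h ▸ hi))
  refine mul_left_cancel₀ (mul_ne_zero (hprod k hkI) (hprod l hlI)) ?_
  linear_combination -key

theorem IsTriple.exists_card_eq {X Y Z : Submodule F (Fin n → F)} {a b c : ℕ}
    (h : IsTriple X Y Z a b c) : ∃ S : Finset (Fin n), S.card = a := by
  have := h.add_eq
  have := h.two_le_mid
  obtain ⟨S, -, hS⟩ := Finset.exists_subset_card_eq (n := a) (s := (Finset.univ : Finset (Fin n)))
    (by rw [Finset.card_univ, Fintype.card_fin]; omega)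
  exact ⟨S, hS⟩

theorem IsTriple.isTwistedFormCode {X Y Z : Submodule F (Fin n → F)} {a b c : ℕ}
    (h : IsTriple X Y Z a b c) {x y : Fin n → F} (hxy : ∀ i k, i ≠ k → bracket x y i k ≠ 0)
    {S : Finset (Fin n)} (hS : S.card = a) (hc : Compatible X x y S) :
    IsTwistedFormCode X x y a := by
  subst hS
  have := h.add_eq
  have := h.two_le_left
  have := h.two_le_mid
  have := h.two_le_right
  exact isTwistedFormCode_of_compatible h.left (fun u hu T hT hc => h.eq_zero hu hT hc)
    (Finset.card_pos.1 (by omega)) (by omega) hxy hc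

/-- The points of one code of a triple are also points of the others. -/
theorem IsTriple.transfer {X Y Z : Submodule F (Fin n → F)} {a b c : ℕ}
    (h : IsTriple X Y Z a b c) {x y : Fin n → F} (hxy : ∀ i k, i ≠ k → bracket x y i k ≠ 0)
    (hX : IsTwistedFormCode X x y a) : IsTwistedFormCode Y x y b := by
  obtain ⟨S, hS⟩ := h.swap.exists_card_eq
  exact h.swap.isTwistedFormCode hxy hS (h.compatible hxy hX hS)

/-- Points enter only through brackets, so coordinate changes of determinant one are harmless. -/
theorem Compatible.congr {X : Submodule F (Fin n → F)} {x y x' y' : Fin n → F}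
    {S : Finset (Fin n)} (h : Compatible X x y S)
    (hb : ∀ i k, bracket x' y' i k = bracket x y i k) : Compatible X x' y' S := by
  unfold Compatible at h ⊢
  simpa only [hb] using h

/-- If the field has at least `n` elements, then coordinates can be chosen such that no point is at
infinity. -/
theorem exists_bracket_eq_of_le_card [Finite F] (hn2 : 2 ≤ n) (hn : n ≤ Nat.card F) {x y : Fin n → F}
    (hxy : ∀ i k, i ≠ k → bracket x y i k ≠ 0) :
    ∃ x' y' : Fin n → F, (∀ k, y' k ≠ 0) ∧ ∀ i k, bracket x' y' i k = bracket x y i k := by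
  classical
  by_cases hy : ∀ k, y k ≠ 0
  · exact ⟨x, y, hy, fun _ _ => rfl⟩
  push Not at hy
  obtain ⟨j, hj⟩ := hy
  have := Fintype.ofFinite F
  rw [Nat.card_eq_fintype_card] at hn
  -- The point `j` lies at infinity, so the others leave some affine value `c` free; `c` is then
  -- moved to infinity.
  obtain ⟨c, -, hc⟩ := Finset.exists_mem_notMem_of_card_lt_card
    (s := (Finset.univ.erase j).image fun k => x k / y k) (t := (Finset.univ : Finset F)) (by
      refine Finset.card_image_le.trans_lt ?_
      have h1 := Finset.card_erase_lt_of_mem (Finset.mem_univ j)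
      rw [Finset.card_univ, Fintype.card_fin] at h1
      rw [Finset.card_univ]
      omega)
  refine ⟨fun k => -y k, fun k => x k - c * y k, fun k hk => ?_, fun i k => ?_⟩
  · dsimp only at hk
    by_cases hkj : k = j
    · subst hkj
      rw [hj, mul_zero, sub_zero] at hk
      exact (ne_zero_of_bracket hn2 hxy k).elim (fun h => h hk) (fun h => h hj)
    · by_cases hyk : y k = 0
      · exact hxy j k (Ne.symm hkj) (by rw [bracket, hj, hyk]; ring)
      · refine hc (Finset.mem_image.2 ⟨k, by simp [hkj], ?_⟩)
        rw [div_eq_iff hyk]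
        linear_combination hk
  · simp only [bracket]
    ring

theorem IsProjGRS.isGRS {X : Submodule F (Fin n → F)} {α : Fin n → F}
    (h : IsProjGRS (fun k => (α k : OnePoint F)) X) : IsGRS α X :=
  ⟨fun _ _ hij => h.1 (congrArg _ hij), h.2⟩

theorem exists_eq_mul_of_mul_eq_mul {x y z w : F} (h : x * w = y * z) (hxy : x ≠ 0 ∨ y ≠ 0)
    (hzw : z ≠ 0 ∨ w ≠ 0) : ∃ m, m ≠ 0 ∧ x = m * z ∧ y = m * w := by
  by_cases hz : z = 0
  · have hw := hzw.resolve_left fun h => h hz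
    have hx : x = 0 := by
      rw [hz, mul_zero] at h
      exact (mul_eq_zero.1 h).resolve_right hw
    exact ⟨y / w, div_ne_zero (hxy.resolve_left fun h => h hx) hw, by rw [hx, hz, mul_zero],
      (div_mul_cancel₀ _ hw).symm⟩
  · have hx : x ≠ 0 := fun hx => by
      rw [hx, zero_mul] at h
      exact (mul_eq_zero.1 h.symm).elim (fun hy => hxy.elim (fun h => h hx) (fun h => h hy)) hz
    refine ⟨x / z, div_ne_zero hx hz, (div_mul_cancel₀ _ hz).symm, ?_⟩
    field_simp
    linear_combination -h

/-! ### Duality -/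

/-- In a triple, each code is the dual of the product of the other two. -/
theorem IsTriple.eq_dualCode {X Y Z : Submodule F (Fin n → F)} {a b c : ℕ}
    (h : IsTriple X Y Z a b c) : X = dualCode (Y * Z) := by
  have hle : X ≤ dualCode (Y * Z) := fun x hx v hv => by
    induction hv using Submodule.mul_induction_on' with
    | mem_mul_mem y hy z hz =>
      rw [← h.orthogonal x hx y hy z hz]
      exact Finset.sum_congr rfl fun i _ => by simp only [Pi.mul_apply]; ring
    | add u _ v _ hu hv => rw [dotProduct_add, hu, hv, add_zero]
  -- Hence words of the larger code too are determined by `a` coordinates, and `X` already realizes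
  -- all values there.
  have h' : IsTriple (dualCode (Y * Z)) Y Z a b c :=
    { h with
      left := h.left.mono hle
      orthogonal := fun x hx y hy z hz => by
        rw [← hx _ (Submodule.mul_mem_mul hy hz)]
        exact Finset.sum_congr rfl fun i _ => by simp only [Pi.mul_apply]; ring }
  obtain ⟨S, hS⟩ := h.exists_card_eq
  have hS0 : ∀ x ∈ dualCode (Y * Z), ∀ s ∈ S, ∃ u ∈ X, ∀ t ∈ S, u t = (Pi.single s (x s) : Fin n → F) t := by
    intro x _ s hs
    obtain ⟨u, hu, hu0, hus⟩ := h.left (S.erase s)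
      ((Finset.card_erase_lt_of_mem hs).trans_eq hS) s (Finset.notMem_erase _ _)
    refine ⟨(x s / u s) • u, X.smul_mem _ hu, fun t ht => ?_⟩
    by_cases hts : t = s
    · subst hts
      simp [hus]
    · simp [hts, hu0 t (Finset.mem_erase.2 ⟨hts, ht⟩)]
  refine le_antisymm hle fun x hx => ?_
  choose! u hu huS using hS0 x hx
  have hxu : x - ∑ s ∈ S, u s = 0 := by
    refine h'.eq_zero (Submodule.sub_mem _ hx (Submodule.sum_mem _ fun s hs => hle (hu s hs)))
      (T := S) (fun t ht => ?_) hS.ge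
    rw [Pi.sub_apply, Finset.sum_apply, Finset.sum_congr rfl fun s hs => huS s hs t ht,
      Finset.sum_eq_single_of_mem t ht fun s _ hst => Pi.single_eq_of_ne (Ne.symm hst) _,
      Pi.single_eq_same, sub_self]
  rw [sub_eq_zero.1 hxu]
  exact Submodule.sum_mem _ hu

/-! ### Extension of scalars and points over the subfield -/

section Extension

variable {K L : Type*} [Field K] [Field L] [Algebra K L]

theorem algebraMap_mem_extendScalars {C : Submodule K (Fin n → K)} {x : Fin n → K} (hx : x ∈ C) :
    (fun i => algebraMap K L (x i)) ∈ extendScalars L C := Submodule.subset_span ⟨x, hx, rfl⟩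

theorem Separates.extendScalars {C : Submodule K (Fin n → K)} {k : ℕ} (hC : Separates C k) :
    Separates (extendScalars L C) k := fun T hT s hs =>
  let ⟨_, hx, hx0, hxs⟩ := hC T hT s hs
  ⟨_, algebraMap_mem_extendScalars hx, fun t ht => by simp [hx0 t ht], by simpa using hxs⟩

theorem bracket_algebraMap (x y : Fin n → K) (i k : Fin n) :
    bracket (fun k => algebraMap K L (x k)) (fun k => algebraMap K L (y k)) i k =
      algebraMap K L (bracket x y i k) := by
  simp [bracket]

theorem bracket_algebraMap_ne_zero {x y : Fin n → K} (hxy : ∀ i k, i ≠ k → bracket x y i k ≠ 0)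
    (i k : Fin n) (hik : i ≠ k) :
    bracket (fun k => algebraMap K L (x k)) (fun k => algebraMap K L (y k)) i k ≠ 0 := by
  rw [bracket_algebraMap]
  simpa using hxy i k hik

/-- For words of `C`, the compatibility identity has both sides in `K`. -/
theorem Compatible.of_extendScalars {C : Submodule K (Fin n → K)} {x y : Fin n → K}
    {S : Finset (Fin n)} (h : Compatible (extendScalars L C) (fun k => algebraMap K L (x k))
      (fun k => algebraMap K L (y k)) S) : Compatible C x y S := by
  intro i hi j hj hij u hu v hv huj hvi k hk l hl
  have := h i hi j hj hij _ (algebraMap_mem_extendScalars hu) _ (algebraMap_mem_extendScalars hv)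
    (fun t ht htj => by simp [huj t ht htj]) (fun t ht hti => by simp [hvi t ht hti]) k hk l hl
  simp only [bracket_algebraMap, ← map_mul] at this
  exact (algebraMap K L).injective this

theorem IsTriple.eq_zero_of_extendScalars {C : Submodule K (Fin n → K)}
    {Y Z : Submodule L (Fin n → L)} {a b c : ℕ} (h : IsTriple (extendScalars L C) Y Z a b c)
    {x : Fin n → K} (hx : x ∈ C) {T : Finset (Fin n)} (hT : ∀ t ∈ T, x t = 0)
    (hc : a ≤ T.card) : x = 0 := by
  have := h.eq_zero (algebraMap_mem_extendScalars hx) (T := T) (fun t ht => by simp [hT t ht]) hc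
  funext i
  simpa using congrFun this i

/-- The evaluation points of a code `X` in a triple, read off from pencils in a code that is
defined over the subfield. -/
theorem IsTriple.exists_compatible {C : Submodule K (Fin n → K)}
    {X Z : Submodule L (Fin n → L)} {a b c : ℕ} (h : IsTriple X (extendScalars L C) Z a b c)
    (hC : Separates C b) (hc : 3 ≤ c) :
    ∃ x y : Fin n → K, (∀ i k, i ≠ k → bracket x y i k ≠ 0) ∧ ∃ S : Finset (Fin n), S.card = a ∧
      Compatible X (fun k => algebraMap K L (x k)) (fun k => algebraMap K L (y k)) S := by
  have hadd := h.add_eq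
  have ha := h.two_le_left
  have hb := h.two_le_mid
  obtain ⟨S, hS⟩ := h.exists_card_eq
  obtain ⟨p, q, r, hpS, hqS, hrS, hpq, hpr, hqr⟩ := Finset.two_lt_card_iff.1
    (show 2 < Sᶜ.card by rw [Finset.card_compl, Fintype.card_fin]; omega)
  rw [Finset.mem_compl] at hpS hqS hrS
  -- The base set varies with `k` in order to avoid it; room for it is where `3 ≤ c` enters.
  have hJ : ∀ k, ∃ J : Finset (Fin n), J.card = b - 2 ∧
      J ⊆ (insert k (insert p (insert q (insert r S))))ᶜ := fun k => by
    obtain ⟨J, hJ, hJc⟩ := Finset.exists_subset_card_eq (n := b - 2)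
      (s := (insert k (insert p (insert q (insert r S))))ᶜ) (by
        have h1 := Finset.card_insert_le k (insert p (insert q (insert r S)))
        have h2 := Finset.card_insert_le p (insert q (insert r S))
        have h3 := Finset.card_insert_le q (insert r S)
        have h4 := Finset.card_insert_le r S
        rw [Finset.card_compl, Fintype.card_fin]
        omega)
    exact ⟨J, hJc, hJ⟩
  choose J hJc hJ using hJ
  have hJ' : ∀ k, ∀ t ∈ J k, t ≠ k ∧ t ≠ p ∧ t ≠ q ∧ t ≠ r ∧ t ∉ S := fun k t ht => by
    have := hJ k ht
    simpa only [Finset.mem_compl, Finset.mem_insert, not_or] using this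
  have hpJ : ∀ k, p ∉ J k := fun k hk => (hJ' k p hk).2.1 rfl
  have hqJ : ∀ k, q ∉ J k := fun k hk => (hJ' k q hk).2.2.1 rfl
  have hrJ : ∀ k, r ∉ J k := fun k hk => (hJ' k r hk).2.2.2.1 rfl
  have hz : ∀ k, ∃ z ∈ C, (∀ t ∈ insert p (J k), z t = 0) ∧ z r ≠ 0 := fun k =>
    hC _ (by rw [Finset.card_insert_of_notMem (hpJ k), hJc]; omega) r
      (by simp [hrJ, Ne.symm hpr])
  have hw : ∀ k, ∃ w ∈ C, (∀ t ∈ insert q (J k), w t = 0) ∧ w r ≠ 0 := fun k =>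
    hC _ (by rw [Finset.card_insert_of_notMem (hqJ k), hJc]; omega) r
      (by simp [hrJ, Ne.symm hqr])
  choose z hzC hz0 hzr using hz
  choose w hwC hw0 hwr using hw
  -- The point `(x k : y k)` is the value at `k` of `z k / w k`, scaled to be `1` at `r`; thus `p`,
  -- `q`, `r` become `0`, `∞`, `1`.
  set x : Fin n → K := fun k => z k k * w k r
  set y : Fin n → K := fun k => w k k * z k r
  have hnz : ∀ k, z k k ≠ 0 ∨ w k k ≠ 0 := by
    intro k
    by_contra! hk
    have hkJ : k ∉ J k := fun hk => (hJ' k k hk).1 rfl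
    by_cases hkp : k = p
    · have hkq : k ≠ q := fun h => hpq (hkp.symm.trans h)
      refine hwr k (congrFun (h.swap.eq_zero_of_extendScalars (hwC k)
        (T := insert k (insert q (J k))) (fun t ht => ?_) ?_) r)
      · rcases Finset.mem_insert.1 ht with rfl | ht
        · exact hk.2
        · exact hw0 k t ht
      · rw [Finset.card_insert_of_notMem (by simp [hkq, hkJ]),
          Finset.card_insert_of_notMem (hqJ k), hJc]
        omega
    · refine hzr k (congrFun (h.swap.eq_zero_of_extendScalars (hzC k)
        (T := insert k (insert p (J k))) (fun t ht => ?_) ?_) r)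
      · rcases Finset.mem_insert.1 ht with rfl | ht
        · exact hk.1
        · exact hz0 k t ht
      · rw [Finset.card_insert_of_notMem (by simp [hkp, hkJ]),
          Finset.card_insert_of_notMem (hpJ k), hJc]
        omega
  have hxy0 : ∀ k, x k ≠ 0 ∨ y k ≠ 0 := fun k =>
    (hnz k).imp (fun h => mul_ne_zero h (hwr k)) (fun h => mul_ne_zero h (hzr k))
  -- Every pencil of `X` with base inside `S` sees the same points. The factor `m` depends on `I`
  -- but not on `i`.
  have hpencil : ∀ I ⊆ S, I.card = a - 2 → ∃ m : Fin n → L, (∀ k ∉ I, m k ≠ 0) ∧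
      ∀ i, ∃ e ∈ X, (∀ k ∈ I, e k = 0) ∧ ∀ k ∉ I, e k = m k * algebraMap K L (bracket x y i k) := by
    intro I hIS hI
    have hpI : p ∉ I := fun h => hpS (hIS h)
    have hqI : q ∉ I := fun h => hqS (hIS h)
    have hrI : r ∉ I := fun h => hrS (hIS h)
    obtain ⟨u, hu, hu0, hur⟩ := h.left (insert p I)
      (by rw [Finset.card_insert_of_notMem hpI]; omega) r (by simp [hrI, Ne.symm hpr])
    obtain ⟨v, hv, hv0, hvr⟩ := h.left (insert q I)
      (by rw [Finset.card_insert_of_notMem hqI]; omega) r (by simp [hrI, Ne.symm hqr])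
    have huv : ∀ k ∉ I, u k ≠ 0 ∨ v k ≠ 0 := by
      intro k hkI
      by_contra! hk
      by_cases hkp : k = p
      · have hkq : k ≠ q := fun h => hpq (hkp.symm.trans h)
        refine hvr (congrFun (h.eq_zero hv (T := insert k (insert q I)) (fun t ht => ?_) ?_) r)
        · rcases Finset.mem_insert.1 ht with rfl | ht
          · exact hk.2
          · exact hv0 t ht
        · rw [Finset.card_insert_of_notMem (by simp [hkq, hkI]),
            Finset.card_insert_of_notMem hqI]
          omega
      · refine hur (congrFun (h.eq_zero hu (T := insert k (insert p I)) (fun t ht => ?_) ?_) r)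
        · rcases Finset.mem_insert.1 ht with rfl | ht
          · exact hk.1
          · exact hu0 t ht
        · rw [Finset.card_insert_of_notMem (by simp [hkp, hkI]),
            Finset.card_insert_of_notMem hpI]
          omega
    have hm : ∀ k, ∃ m : L, k ∉ I → m ≠ 0 ∧ u k * v r = m * algebraMap K L (x k) ∧
        v k * u r = m * algebraMap K L (y k) := by
      intro k
      by_cases hkI : k ∈ I
      · exact ⟨0, fun h => absurd hkI h⟩
      have key := h.pencil_eq hu hv (algebraMap_mem_extendScalars (hzC k))
        (algebraMap_mem_extendScalars (hwC k)) (I := I) (J := J k) (by omega)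
        (by rw [hJc]; omega)
        (Finset.disjoint_left.2 fun t ht h => (hJ' k t h).2.2.2.2 (hIS ht)) hpq hpr hqr
        (by simp [hpI, hpJ]) (by simp [hqI, hqJ]) (by simp [hrI, hrJ])
        (fun t ht => hu0 t (Finset.mem_insert_of_mem ht))
        (fun t ht => hv0 t (Finset.mem_insert_of_mem ht))
        (fun t ht => by simp [hz0 k t (Finset.mem_insert_of_mem ht)])
        (fun t ht => by simp [hw0 k t (Finset.mem_insert_of_mem ht)])
        (hu0 p (Finset.mem_insert_self _ _)) (hv0 q (Finset.mem_insert_self _ _))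
        (by simp [hz0 k p (Finset.mem_insert_self _ _)])
        (by simp [hw0 k q (Finset.mem_insert_self _ _)]) k
      obtain ⟨m, hm0, hm⟩ := exists_eq_mul_of_mul_eq_mul (x := u k * v r) (y := v k * u r)
        (z := algebraMap K L (x k)) (w := algebraMap K L (y k))
        (by simp only [x, y, map_mul]; linear_combination key)
        ((huv k hkI).imp (fun h => mul_ne_zero h hvr) (fun h => mul_ne_zero h hur))
        (by simpa using hxy0 k)
      exact ⟨m, fun _ => ⟨hm0, hm⟩⟩
    choose m hm using hm
    refine ⟨m, fun k hk => (hm k hk).1, fun i => ⟨(algebraMap K L (y i) * v r) • u -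
      (algebraMap K L (x i) * u r) • v, X.sub_mem (X.smul_mem _ hu) (X.smul_mem _ hv),
      fun k hk => ?_, fun k hk => ?_⟩⟩
    · simp [hu0 k (Finset.mem_insert_of_mem hk), hv0 k (Finset.mem_insert_of_mem hk)]
    · obtain ⟨-, h1, h2⟩ := hm k hk
      simp only [Pi.sub_apply, Pi.smul_apply, smul_eq_mul, bracket, map_sub, map_mul]
      linear_combination algebraMap K L (y i) * h1 - algebraMap K L (x i) * h2
  -- If points `i` and `k` coincided, the pencil word for `i` would have `a` zeros and vanish. Then
  -- `i` would coincide with every point outside `S`, in particular with both `0` and `∞`.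
  have hxy : ∀ i k, i ≠ k → bracket x y i k ≠ 0 := by
    intro i k hik h0
    obtain ⟨I, hIs, hI⟩ := Finset.exists_subset_card_eq (n := a - 2) (s := (S.erase i).erase k)
      (by
        have h1 := Finset.pred_card_le_card_erase (s := S.erase i) (a := k)
        have h2 := Finset.pred_card_le_card_erase (s := S) (a := i)
        omega)
    have hIS : I ⊆ S := hIs.trans ((Finset.erase_subset _ _).trans (Finset.erase_subset _ _))
    have hkI : k ∉ I := fun h => Finset.notMem_erase _ _ (hIs h)
    have hiI : i ∉ I := fun h => Finset.notMem_erase _ _ (Finset.mem_of_mem_erase (hIs h))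
    obtain ⟨m, hm, he⟩ := hpencil I hIS hI
    obtain ⟨e, heX, he0, he⟩ := he i
    have hezero : e = 0 := by
      refine h.eq_zero heX (T := insert i (insert k I)) (fun t ht => ?_) (by
        rw [Finset.card_insert_of_notMem (by simp [hik, hiI]),
          Finset.card_insert_of_notMem hkI]
        omega)
      rcases Finset.mem_insert.1 ht with rfl | ht
      · rw [he _ hiI, bracket_self, map_zero, mul_zero]
      rcases Finset.mem_insert.1 ht with rfl | ht
      · rw [he _ hkI, h0, map_zero, mul_zero]
      · exact he0 t ht
    have hbr : ∀ t ∉ S, bracket x y i t = 0 := fun t ht => by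
      have htI : t ∉ I := fun h => ht (hIS h)
      have h1 := he t htI
      rw [hezero, Pi.zero_apply, eq_comm, mul_eq_zero] at h1
      simpa using h1.resolve_left (hm t htI)
    have hxp : x p = 0 := by simp [x, hz0 p p (Finset.mem_insert_self _ _)]
    have hyq : y q = 0 := by simp [y, hw0 q q (Finset.mem_insert_self _ _)]
    have h1 := hbr p hpS
    have h2 := hbr q hqS
    rw [bracket, hxp, zero_mul, zero_sub, neg_eq_zero] at h1
    rw [bracket, hyq, zero_mul, sub_zero] at h2
    exact (hxy0 i).elim
      (fun h => h ((mul_eq_zero.1 h1).resolve_left ((hxy0 p).resolve_left fun h => h hxp)))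
      (fun h => h ((mul_eq_zero.1 h2).resolve_left ((hxy0 q).resolve_right fun h => h hyq)))
  refine ⟨x, y, hxy, S, hS, ?_⟩
  intro i hi j hj hij u hu v hv huj hvi k hk l hl
  have hji : j ∈ S.erase i := Finset.mem_erase.2 ⟨Ne.symm hij, hj⟩
  obtain ⟨m, hm, he⟩ := hpencil ((S.erase i).erase j)
    ((Finset.erase_subset _ _).trans (Finset.erase_subset _ _))
    (by rw [Finset.card_erase_of_mem hji, Finset.card_erase_of_mem hi]; omega)
  have hmem : ∀ t ∉ S, t ∉ (S.erase i).erase j := fun t ht h =>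
    ht (Finset.mem_of_mem_erase (Finset.mem_of_mem_erase h))
  -- Having `a - 1` common zeros, `u` is proportional to the pencil word for `i`, and `v` to that
  -- for `j`.
  obtain ⟨e, heX, he0, he1⟩ := he i
  obtain ⟨f, hfX, hf0, hf1⟩ := he j
  have h1 := h.mul_eq_mul hu heX (T := S.erase j)
    (fun t ht => huj t (Finset.mem_of_mem_erase ht) (Finset.ne_of_mem_erase ht))
    (fun t ht => by
      by_cases hti : t = i
      · rw [hti, he1 i (fun h => Finset.notMem_erase _ _ (Finset.mem_of_mem_erase h)),
          bracket_self, map_zero, mul_zero]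
      · exact he0 t (Finset.mem_erase.2 ⟨Finset.ne_of_mem_erase ht,
          Finset.mem_erase.2 ⟨hti, Finset.mem_of_mem_erase ht⟩⟩))
    (by rw [Finset.card_erase_add_one hj, hS]) k l
  have h2 := h.mul_eq_mul hv hfX (T := S.erase i)
    (fun t ht => hvi t (Finset.mem_of_mem_erase ht) (Finset.ne_of_mem_erase ht))
    (fun t ht => by
      by_cases htj : t = j
      · rw [htj, hf1 j (Finset.notMem_erase _ _), bracket_self, map_zero, mul_zero]
      · exact hf0 t (Finset.mem_erase.2 ⟨htj, ht⟩))
    (by rw [Finset.card_erase_add_one hi, hS]) k l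
  rw [he1 k (hmem k hk), he1 l (hmem l hl)] at h1
  rw [hf1 k (hmem k hk), hf1 l (hmem l hl)] at h2
  simp only [bracket_algebraMap]
  refine mul_left_cancel₀ (mul_ne_zero (hm k (hmem k hk)) (hm l (hmem l hl))) ?_
  linear_combination v l * m k * algebraMap K L (bracket x y j k) * h1 -
    u l * m k * algebraMap K L (bracket x y i k) * h2

theorem IsTriple.grs_and_eq_dualCode [Finite K] [Finite L] {C : Submodule K (Fin n → K)}
    {A B : Submodule L (Fin n → L)} {a b c : ℕ} (hC : Separates C c)
    (h : IsTriple A B (extendScalars L C) a b c) (ha : 3 ≤ a) :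
    (∃ α : Fin n → OnePoint K, IsProjGRS α C ∧
      IsProjGRS (fun i => OnePoint.map (algebraMap K L) (α i)) A ∧
      IsProjGRS (fun i => OnePoint.map (algebraMap K L) (α i)) B) ∧
    (n ≤ Nat.card K → ∃ α : Fin n → K, IsGRS α C ∧
      IsGRS (fun i => algebraMap K L (α i)) A ∧ IsGRS (fun i => algebraMap K L (α i)) B) ∧
    (n ≤ Nat.card L → ∃ α : Fin n → L, IsGRS α (extendScalars L C) ∧ IsGRS α A ∧ IsGRS α B) ∧
    B = dualCode (A * extendScalars L C) := by
  -- The points are those of `B`, computed from pencils in `C`; `A` is the third code, so `3 ≤ a` is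
  -- the condition needed.
  obtain ⟨x, y, hxy, S, hS, hcomp⟩ := h.rotate.exists_compatible hC ha
  have hbL : ∀ x' y' : Fin n → L, (∀ i k, bracket x' y' i k =
      bracket (fun k => algebraMap K L (x k)) (fun k => algebraMap K L (y k)) i k) →
      ∀ i k, i ≠ k → bracket x' y' i k ≠ 0 := fun x' y' hb i k hik => by
    rw [hb]
    exact bracket_algebraMap_ne_zero hxy i k hik
  have hB : ∀ x' y' : Fin n → L, (∀ i k, bracket x' y' i k =
      bracket (fun k => algebraMap K L (x k)) (fun k => algebraMap K L (y k)) i k) →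
      IsTwistedFormCode B x' y' b := fun x' y' hb =>
    h.rotate.isTwistedFormCode (hbL x' y' hb) hS (hcomp.congr hb)
  have hA : ∀ x' y' : Fin n → L, (∀ i k, bracket x' y' i k =
      bracket (fun k => algebraMap K L (x k)) (fun k => algebraMap K L (y k)) i k) →
      IsTwistedFormCode A x' y' a := fun x' y' hb => h.swap.transfer (hbL x' y' hb) (hB x' y' hb)
  have hCL : ∀ x' y' : Fin n → L, (∀ i k, bracket x' y' i k =
      bracket (fun k => algebraMap K L (x k)) (fun k => algebraMap K L (y k)) i k) →
      IsTwistedFormCode (extendScalars L C) x' y' c := fun x' y' hb =>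
    h.rotate.transfer (hbL x' y' hb) (hB x' y' hb)
  have hbK : ∀ x' y' : Fin n → K, (∀ i k, bracket x' y' i k = bracket x y i k) → ∀ i k,
      bracket (fun k => algebraMap K L (x' k)) (fun k => algebraMap K L (y' k)) i k =
      bracket (fun k => algebraMap K L (x k)) (fun k => algebraMap K L (y k)) i k :=
    fun x' y' hb i k => by rw [bracket_algebraMap, bracket_algebraMap, hb]
  have hadd := h.add_eq
  have hb := h.two_le_mid
  have hc := h.two_le_right
  have hCK : ∀ x' y' : Fin n → K, (∀ i k, bracket x' y' i k = bracket x y i k) →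
      IsTwistedFormCode C x' y' c := fun x' y' hb => by
    obtain ⟨T, hT⟩ := h.rotate.rotate.exists_card_eq
    have hxy' : ∀ i k, i ≠ k → bracket x' y' i k ≠ 0 := fun i k hik => by
      rw [hb]
      exact hxy i k hik
    have hcompC := (h.rotate.compatible (hbL _ _ (hbK x' y' hb)) (hB _ _ (hbK x' y' hb))
      hT).of_extendScalars
    subst hT
    exact isTwistedFormCode_of_compatible hC
      (fun u hu U hU hc => h.rotate.rotate.eq_zero_of_extendScalars hu hU hc)
      (Finset.card_pos.1 (by omega)) (by omega) hxy' hcompC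
  refine ⟨⟨fun k => toOnePoint (x k) (y k), (hCK x y fun _ _ => rfl).isProjGRS, ?_, ?_⟩,
    fun hn => ?_, fun hn => ?_, h.swap.eq_dualCode⟩
  · simp only [map_toOnePoint]
    exact (hA _ _ fun _ _ => rfl).isProjGRS
  · simp only [map_toOnePoint]
    exact (hB _ _ fun _ _ => rfl).isProjGRS
  · obtain ⟨x', y', hy, hb⟩ := exists_bracket_eq_of_le_card (by omega) hn hxy
    have hy' : ∀ k, algebraMap K L (y' k) ≠ 0 := fun k => by simpa using hy k
    refine ⟨fun k => x' k / y' k, ?_, ?_, ?_⟩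
    · have := (hCK x' y' hb).isProjGRS
      simp only [toOnePoint_of_ne_zero _ (hy _)] at this
      exact this.isGRS
    · have := (hA _ _ (hbK x' y' hb)).isProjGRS
      simp only [toOnePoint_of_ne_zero _ (hy' _), ← map_div₀] at this
      exact this.isGRS
    · have := (hB _ _ (hbK x' y' hb)).isProjGRS
      simp only [toOnePoint_of_ne_zero _ (hy' _), ← map_div₀] at this
      exact this.isGRS
  · obtain ⟨x', y', hy, hb⟩ := exists_bracket_eq_of_le_card (by omega) hn
      (hbL _ _ fun _ _ => rfl)
    refine ⟨fun k => x' k / y' k, ?_, ?_, ?_⟩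
    · have := (hCL x' y' hb).isProjGRS
      simp only [toOnePoint_of_ne_zero _ (hy _)] at this
      exact this.isGRS
    · have := (hA x' y' hb).isProjGRS
      simp only [toOnePoint_of_ne_zero _ (hy _)] at this
      exact this.isGRS
    · have := (hB x' y' hb).isProjGRS
      simp only [toOnePoint_of_ne_zero _ (hy _)] at this
      exact this.isGRS

end Extension

end ErrorCorrectingPair

/-! ### The two cases of the theorem -/

open ErrorCorrectingPair in
theorem theorem5p1 {K L : Type*} [Field K] [Finite K] [Field L] [Finite L] [Algebra K L]
    (n ℓ : ℕ) (hℓ : 2 ≤ ℓ) (hn : (ℓ : ℝ) < (n : ℝ) / 2 - 1)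
    (C : Submodule K (Fin n → K)) (A B : Submodule L (Fin n → L))
    (hC : ErrorCorrectingPair.HasParams C (n - 2 * ℓ - 1) (2 * ℓ + 2))
    (hAB : ErrorCorrectingPair.IsECP ℓ A B C)
    (hA : ErrorCorrectingPair.HasParams A (ℓ + 2) (n - ℓ - 1) ∨
      (ErrorCorrectingPair.HasParams A (ℓ + 1) (n - ℓ) ∧
        ((ℓ + 1 : ℕ) : ℕ∞) < ErrorCorrectingPair.minDist (ErrorCorrectingPair.dualCode B))) :
    -- a common sequence of points of `K ∪ {∞}`, without any condition on the field sizes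
    (∃ α : Fin n → OnePoint K,
      ErrorCorrectingPair.IsProjGRS α C ∧
      ErrorCorrectingPair.IsProjGRS (fun i => OnePoint.map (algebraMap K L) (α i)) A ∧
      ErrorCorrectingPair.IsProjGRS (fun i => OnePoint.map (algebraMap K L) (α i)) B) ∧
    -- a common sequence of points of `K`, as soon as `K` has `n` elements
    (n ≤ Nat.card K → ∃ α : Fin n → K,
      ErrorCorrectingPair.IsGRS α C ∧
      ErrorCorrectingPair.IsGRS (fun i => algebraMap K L (α i)) A ∧
      ErrorCorrectingPair.IsGRS (fun i => algebraMap K L (α i)) B) ∧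
    -- a common sequence of points of `L` (with `C` seen over `L`), as soon as `L` has `n` elements
    (n ≤ Nat.card L → ∃ α : Fin n → L,
      ErrorCorrectingPair.IsGRS α (ErrorCorrectingPair.extendScalars L C) ∧
      ErrorCorrectingPair.IsGRS α A ∧
      ErrorCorrectingPair.IsGRS α B) ∧
    B = ErrorCorrectingPair.dualCode (A * ErrorCorrectingPair.extendScalars L C) := by
  -- This gives `n - 2 * ℓ - 1 ≥ 2`, so `C` is large enough to contain pencils.
  have hn' : 2 * ℓ + 3 ≤ n := by
    have h1 : ((2 * ℓ + 2 : ℕ) : ℝ) < n := by push_cast; linarith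
    exact_mod_cast h1
  have hCs : Separates C (n - 2 * ℓ - 1) := by
    refine separates_of_lt_minDist hC.1 (by omega) ?_
    rw [hC.2]
    norm_cast
    omega
  have horth : ∀ x ∈ A, ∀ y ∈ B, ∀ z ∈ extendScalars L C, (x * y) ⬝ᵥ z = 0 :=
    fun x hx y hy z hz => hAB.mul_le_dual (Submodule.mul_mem_mul hx hy) z hz
  rcases hA with hA | ⟨hA, hB⟩
  · have hAs : Separates A (ℓ + 2) := by
      refine separates_of_lt_minDist hA.1 (by omega) ?_
      rw [hA.2]
      norm_cast
      omega
    exact IsTriple.grs_and_eq_dualCode hCs ⟨hAs,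
      separates_of_lt_minDist_dualCode hAB.lt_minDist_dual, hCs.extendScalars, by omega, hℓ,
      by omega, by omega, horth⟩ (by omega)
  · have hAs : Separates A (ℓ + 1) := by
      refine separates_of_lt_minDist hA.1 (by omega) ?_
      rw [hA.2]
      norm_cast
      omega
    exact IsTriple.grs_and_eq_dualCode hCs ⟨hAs, separates_of_lt_minDist_dualCode hB,
      hCs.extendScalars, by omega, by omega, by omega, by omega, horth⟩ (by omega)
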